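/- Let $U(\mathfrak{sl}_2)$ be the unital associative $\mathbb C$-algebra generated by $E,F,H$ subject to the relations $[H,E]=2E$, $[H,F]=-2F$, $[E,F]=H$, where $[x,y]=xy-yx$. Let $\Re$ be the universal Racah algebra, i.e. the unital associative $\mathbb C$-algebra generated by $A,B,C,\Delta$ subject to the relations asserting that $[A,B]=[B,C]=[C,A]=2\Delta$ and that each of $[A,\Delta]+AC-BA$, $[B,\Delta]+BA-CB$, $[C,\Delta]+CB-AC$ is central in $\Re$. Let $\sharp:\Re\to U(\mathfrak{sl}_2)$ be the algebra homomorphism given by $$A\mapsto \frac{(E+F-2)(E+F+2)}{16},\qquad B\mapsto \frac{(H-2)(H+2)}{16},$$ $$C\mapsto \frac{(\mathbf iE-\mathbf iF-2)(\mathbf iE-\mathbf iF+2)}{16},\qquad \Delta\mapsto \frac{(H+2)F^2-(H-2)E^2}{64},$$ where $\mathbf i=\sqrt{-1}$. A square matrix is irreducible tridiagonal if all its nonzero entries lie on the diagonal, the subdiagonal or the superdiagonal, and every entry on the subdiagonal and on the superdiagonal is nonzero. An ordered triple $L_1,L_2,L_3$ of linear operators on a vector space of finite positive dimension is a Leonard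 triple if for each $i\in\{1,2,3\}$ there is a basis of the space with respect to which the matrix representing $L_i$ is diagonal and the matrices representing the other two operators are irreducible tridiagonal. A module is completely reducible if it is isomorphic to a (possibly empty) direct sum of irreducible modules. **Theorem.** Let $V$ be a finite-dimensional $U(\mathfrak{sl}_2)$-module, regarded as an $\Re$-module by pulling back via $\sharp$. Then: 1. The $\Re$-module $V$ is completely reducible. 2. For every irreducible $\Re$-submodule $W$ of $V$, the actions of $A,B,C$ on $W$ (in this order) form a Leonard triple. -/

import Mathlib

open scoped DirectSum

universe u

set_option linter.unusedSimpArgs false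

noncomputable section

/-! ### The universal enveloping algebra of `sl₂`, by generators and relations -/

/-- The three generators of `U(sl₂)`. -/
inductive Sl2Gen : Type
  | E
  | F
  | H

/-- The defining relations of `U(sl₂)`:
`[H,E] = 2E`, `[H,F] = -2F`, `[E,F] = H`; the brackets are commutators. -/
inductive Sl2Rel : FreeAlgebra ℂ Sl2Gen → FreeAlgebra ℂ Sl2Gen → Prop
  | he : Sl2Rel ⁅FreeAlgebra.ι ℂ Sl2Gen.H, FreeAlgebra.ι ℂ Sl2Gen.E⁆
      (2 * FreeAlgebra.ι ℂ Sl2Gen.E)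
  | hf : Sl2Rel ⁅FreeAlgebra.ι ℂ Sl2Gen.H, FreeAlgebra.ι ℂ Sl2Gen.F⁆
      (-2 * FreeAlgebra.ι ℂ Sl2Gen.F)
  | ef : Sl2Rel ⁅FreeAlgebra.ι ℂ Sl2Gen.E, FreeAlgebra.ι ℂ Sl2Gen.F⁆
      (FreeAlgebra.ι ℂ Sl2Gen.H)

/-- The universal enveloping algebra `U(sl₂)` over `ℂ`. -/
def USl2 : Type := RingQuot Sl2Rel

namespace USl2

instance instRing : Ring USl2 := inferInstanceAs (Ring (RingQuot Sl2Rel))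

instance instAlgebra : Algebra ℂ USl2 := inferInstanceAs (Algebra ℂ (RingQuot Sl2Rel))

/-- The quotient map from the free algebra. -/
def mk : FreeAlgebra ℂ Sl2Gen →ₐ[ℂ] USl2 := RingQuot.mkAlgHom ℂ Sl2Rel

/-- The generator `E` of `U(sl₂)`. -/
def E : USl2 := mk (FreeAlgebra.ι ℂ Sl2Gen.E)

/-- The generator `F` of `U(sl₂)`. -/
def F : USl2 := mk (FreeAlgebra.ι ℂ Sl2Gen.F)

/-- The generator `H` of `U(sl₂)`. -/
def H : USl2 := mk (FreeAlgebra.ι ℂ Sl2Gen.H)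

theorem mk_rel {x y : FreeAlgebra ℂ Sl2Gen} (h : Sl2Rel x y) : mk x = mk y :=
  RingQuot.mkAlgHom_rel ℂ h

theorem H_mul_E : H * E = E * H + (2 : ℂ) • E := by
  have h := mk_rel Sl2Rel.he
  rw [Ring.lie_def, map_sub, map_mul, map_mul, map_mul, map_ofNat] at h
  change H * E - E * H = 2 * E at h
  rw [sub_eq_iff_eq_add] at h
  rw [h, two_mul, two_smul, add_comm]

theorem H_mul_F : H * F = F * H - (2 : ℂ) • F := by
  have h := mk_rel Sl2Rel.hf
  rw [Ring.lie_def, map_sub, map_mul, map_mul, map_mul, map_neg, map_ofNat] at h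
  change H * F - F * H = -2 * F at h
  rw [sub_eq_iff_eq_add] at h
  rw [h, neg_mul, two_mul, two_smul]
  abel

theorem F_mul_E : F * E = E * F - H := by
  have h := mk_rel Sl2Rel.ef
  rw [Ring.lie_def, map_sub, map_mul, map_mul] at h
  change E * F - F * E = H at h
  rw [← h]
  abel

end USl2

/-! ### The universal Racah algebra -/

/-- The four generators of the universal Racah algebra. -/
inductive RacahGen : Type
  | A
  | B
  | C
  | Δ

namespace RacahFree

/-- The free generator `A`. -/
abbrev A : FreeAlgebra ℂ RacahGen := FreeAlgebra.ι ℂ RacahGen.A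

/-- The free generator `B`. -/
abbrev B : FreeAlgebra ℂ RacahGen := FreeAlgebra.ι ℂ RacahGen.B

/-- The free generator `C`. -/
abbrev C : FreeAlgebra ℂ RacahGen := FreeAlgebra.ι ℂ RacahGen.C

/-- The free generator `Δ`. -/
abbrev Δ : FreeAlgebra ℂ RacahGen := FreeAlgebra.ι ℂ RacahGen.Δ

/-- The defining relations of the universal Racah algebra: `[A,B] = [B,C] = [C,A] = 2Δ`, and each of
`[A,Δ] + AC - BA`, `[B,Δ] + BA - CB`, `[C,Δ] + CB - AC` commutes with every element. -/
inductive Rel : FreeAlgebra ℂ RacahGen → FreeAlgebra ℂ RacahGen → Prop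
  | ab : Rel ⁅A, B⁆ (2 * Δ)
  | bc : Rel ⁅B, C⁆ (2 * Δ)
  | ca : Rel ⁅C, A⁆ (2 * Δ)
  | central_a (x : FreeAlgebra ℂ RacahGen) :
      Rel ((⁅A, Δ⁆ + A * C - B * A) * x) (x * (⁅A, Δ⁆ + A * C - B * A))
  | central_b (x : FreeAlgebra ℂ RacahGen) :
      Rel ((⁅B, Δ⁆ + B * A - C * B) * x) (x * (⁅B, Δ⁆ + B * A - C * B))
  | central_c (x : FreeAlgebra ℂ RacahGen) :
      Rel ((⁅C, Δ⁆ + C * B - A * C) * x) (x * (⁅C, Δ⁆ + C * B - A * C))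

end RacahFree

/-- The universal Racah algebra `ℜ` over `ℂ`. -/
def Racah : Type := RingQuot RacahFree.Rel

namespace Racah

instance instRing : Ring Racah := inferInstanceAs (Ring (RingQuot RacahFree.Rel))

instance instAlgebra : Algebra ℂ Racah := inferInstanceAs (Algebra ℂ (RingQuot RacahFree.Rel))

/-- The quotient map from the free algebra. -/
def mk : FreeAlgebra ℂ RacahGen →ₐ[ℂ] Racah := RingQuot.mkAlgHom ℂ RacahFree.Rel

/-- The generator `A` of `ℜ`. -/
def A : Racah := mk RacahFree.A

/-- The generator `B` of `ℜ`. -/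
def B : Racah := mk RacahFree.B

/-- The generator `C` of `ℜ`. -/
def C : Racah := mk RacahFree.C

/-- The generator `Δ` of `ℜ`. -/
def Δ : Racah := mk RacahFree.Δ

/-! ### The homomorphism `♯ : ℜ → U(sl₂)` -/

open USl2 (E F H)

/-- The images of the generators of `ℜ` under `♯`. -/
def sharpGen : RacahGen → USl2
  | RacahGen.A => (1 / 16 : ℂ) • ((E + F - 2) * (E + F + 2))
  | RacahGen.B => (1 / 16 : ℂ) • ((H - 2) * (H + 2))
  | RacahGen.C => (1 / 16 : ℂ) •
      ((Complex.I • E - Complex.I • F - 2) * (Complex.I • E - Complex.I • F + 2))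
  | RacahGen.Δ => (1 / 64 : ℂ) • ((H + 2) * F ^ 2 - (H - 2) * E ^ 2)

theorem two_eq_smul : (2 : USl2) = (2 : ℂ) • (1 : USl2) := by
  rw [two_smul]; norm_num

theorem sharpGen_A : sharpGen RacahGen.A =
    (1 / 16 : ℂ) • ((E + F) * (E + F) - (4 : ℂ) • (1 : USl2)) := by
  simp only [sharpGen, two_eq_smul, mul_add, add_mul, mul_sub, sub_mul, smul_mul_assoc,
    mul_smul_comm, one_mul, mul_one]
  module

theorem sharpGen_B : sharpGen RacahGen.B =
    (1 / 16 : ℂ) • (H * H - (4 : ℂ) • (1 : USl2)) := by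
  simp only [sharpGen, two_eq_smul, mul_add, add_mul, mul_sub, sub_mul, smul_mul_assoc,
    mul_smul_comm, one_mul, mul_one]
  module

theorem sharpGen_C : sharpGen RacahGen.C =
    (-1 / 16 : ℂ) • ((E - F) * (E - F) + (4 : ℂ) • (1 : USl2)) := by
  simp only [sharpGen, two_eq_smul, mul_add, add_mul, mul_sub, sub_mul, smul_mul_assoc,
    mul_smul_comm, one_mul, mul_one, smul_sub, smul_add, smul_smul, Complex.I_mul_I]
  module

theorem sharpGen_Δ : sharpGen RacahGen.Δ =
    (1 / 64 : ℂ) • (H * (F * F) + (2 : ℂ) • (F * F) - H * (E * E) + (2 : ℂ) • (E * E)) := by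
  simp only [sharpGen, two_eq_smul, mul_add, add_mul, mul_sub, sub_mul, smul_mul_assoc,
    mul_smul_comm, one_mul, mul_one, pow_two]
  module

theorem H_mul_E_mul (x : USl2) : H * (E * x) = E * (H * x) + (2 : ℂ) • (E * x) := by
  rw [← mul_assoc, USl2.H_mul_E, add_mul, smul_mul_assoc, mul_assoc]

theorem H_mul_F_mul (x : USl2) : H * (F * x) = F * (H * x) - (2 : ℂ) • (F * x) := by
  rw [← mul_assoc, USl2.H_mul_F, sub_mul, smul_mul_assoc, mul_assoc]

theorem F_mul_E_mul (x : USl2) : F * (E * x) = E * (F * x) - H * x := by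
  rw [← mul_assoc, USl2.F_mul_E, sub_mul, mul_assoc]

theorem sharp_ab : sharpGen RacahGen.A * sharpGen RacahGen.B
    - sharpGen RacahGen.B * sharpGen RacahGen.A = 2 * sharpGen RacahGen.Δ := by
  rw [two_eq_smul, sharpGen_A, sharpGen_B, sharpGen_Δ]
  simp only [mul_add, add_mul, mul_sub, sub_mul, smul_mul_assoc, mul_smul_comm, one_mul, mul_one,
    smul_sub, smul_add, mul_assoc, USl2.H_mul_E, USl2.H_mul_F, USl2.F_mul_E, H_mul_E_mul,
    H_mul_F_mul, F_mul_E_mul]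
  module

theorem sharp_bc : sharpGen RacahGen.B * sharpGen RacahGen.C
    - sharpGen RacahGen.C * sharpGen RacahGen.B = 2 * sharpGen RacahGen.Δ := by
  rw [two_eq_smul, sharpGen_C, sharpGen_B, sharpGen_Δ]
  simp only [mul_add, add_mul, mul_sub, sub_mul, smul_mul_assoc, mul_smul_comm, one_mul, mul_one,
    smul_sub, smul_add, mul_assoc, USl2.H_mul_E, USl2.H_mul_F, USl2.F_mul_E, H_mul_E_mul,
    H_mul_F_mul, F_mul_E_mul]
  module

theorem sharp_ca : sharpGen RacahGen.C * sharpGen RacahGen.A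
    - sharpGen RacahGen.A * sharpGen RacahGen.C = 2 * sharpGen RacahGen.Δ := by
  rw [two_eq_smul, sharpGen_C, sharpGen_A, sharpGen_Δ]
  simp only [mul_add, add_mul, mul_sub, sub_mul, smul_mul_assoc, mul_smul_comm, one_mul, mul_one,
    smul_sub, smul_add, mul_assoc, USl2.H_mul_E, USl2.H_mul_F, USl2.F_mul_E, H_mul_E_mul,
    H_mul_F_mul, F_mul_E_mul]
  module

theorem sharp_alpha : (sharpGen RacahGen.A * sharpGen RacahGen.Δ
    - sharpGen RacahGen.Δ * sharpGen RacahGen.A) + sharpGen RacahGen.A * sharpGen RacahGen.C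
    - sharpGen RacahGen.B * sharpGen RacahGen.A = 0 := by
  rw [sharpGen_A, sharpGen_B, sharpGen_C, sharpGen_Δ]
  simp only [mul_add, add_mul, mul_sub, sub_mul, smul_mul_assoc, mul_smul_comm, one_mul, mul_one,
    smul_sub, smul_add, mul_assoc, USl2.H_mul_E, USl2.H_mul_F, USl2.F_mul_E, H_mul_E_mul,
    H_mul_F_mul, F_mul_E_mul]
  module

theorem sharp_beta : (sharpGen RacahGen.B * sharpGen RacahGen.Δ
    - sharpGen RacahGen.Δ * sharpGen RacahGen.B) + sharpGen RacahGen.B * sharpGen RacahGen.A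
    - sharpGen RacahGen.C * sharpGen RacahGen.B = 0 := by
  rw [sharpGen_A, sharpGen_B, sharpGen_C, sharpGen_Δ]
  simp only [mul_add, add_mul, mul_sub, sub_mul, smul_mul_assoc, mul_smul_comm, one_mul, mul_one,
    smul_sub, smul_add, mul_assoc, USl2.H_mul_E, USl2.H_mul_F, USl2.F_mul_E, H_mul_E_mul,
    H_mul_F_mul, F_mul_E_mul]
  module

theorem sharp_gamma : (sharpGen RacahGen.C * sharpGen RacahGen.Δ
    - sharpGen RacahGen.Δ * sharpGen RacahGen.C) + sharpGen RacahGen.C * sharpGen RacahGen.B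
    - sharpGen RacahGen.A * sharpGen RacahGen.C = 0 := by
  rw [sharpGen_A, sharpGen_B, sharpGen_C, sharpGen_Δ]
  simp only [mul_add, add_mul, mul_sub, sub_mul, smul_mul_assoc, mul_smul_comm, one_mul, mul_one,
    smul_sub, smul_add, mul_assoc, USl2.H_mul_E, USl2.H_mul_F, USl2.F_mul_E, H_mul_E_mul,
    H_mul_F_mul, F_mul_E_mul]
  module

theorem lift_rel ⦃x y : FreeAlgebra ℂ RacahGen⦄ (h : RacahFree.Rel x y) :
    FreeAlgebra.lift ℂ sharpGen x = FreeAlgebra.lift ℂ sharpGen y := by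
  cases h with
  | ab =>
    rw [Ring.lie_def, map_sub, map_mul, map_mul, map_mul, map_ofNat]
    simpa only [FreeAlgebra.lift_ι_apply] using sharp_ab
  | bc =>
    rw [Ring.lie_def, map_sub, map_mul, map_mul, map_mul, map_ofNat]
    simpa only [FreeAlgebra.lift_ι_apply] using sharp_bc
  | ca =>
    rw [Ring.lie_def, map_sub, map_mul, map_mul, map_mul, map_ofNat]
    simpa only [FreeAlgebra.lift_ι_apply] using sharp_ca
  | central_a x => simp [Ring.lie_def, sharp_alpha]
  | central_b x => simp [Ring.lie_def, sharp_beta]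
  | central_c x => simp [Ring.lie_def, sharp_gamma]

/-- The algebra homomorphism `♯ : ℜ → U(sl₂)` with the values `sharpGen` on the generators. -/
def sharp : Racah →ₐ[ℂ] USl2 :=
  RingQuot.liftAlgHom ℂ ⟨FreeAlgebra.lift ℂ sharpGen, lift_rel⟩

theorem sharp_A : sharp A = (1 / 16 : ℂ) • ((E + F - 2) * (E + F + 2)) := by
  change RingQuot.liftAlgHom ℂ _ (RingQuot.mkAlgHom ℂ RacahFree.Rel RacahFree.A) = _
  rw [RingQuot.liftAlgHom_mkAlgHom_apply, FreeAlgebra.lift_ι_apply, sharpGen]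

theorem sharp_B : sharp B = (1 / 16 : ℂ) • ((H - 2) * (H + 2)) := by
  change RingQuot.liftAlgHom ℂ _ (RingQuot.mkAlgHom ℂ RacahFree.Rel RacahFree.B) = _
  rw [RingQuot.liftAlgHom_mkAlgHom_apply, FreeAlgebra.lift_ι_apply, sharpGen]

theorem sharp_C : sharp C = (1 / 16 : ℂ) •
    ((Complex.I • E - Complex.I • F - 2) * (Complex.I • E - Complex.I • F + 2)) := by
  change RingQuot.liftAlgHom ℂ _ (RingQuot.mkAlgHom ℂ RacahFree.Rel RacahFree.C) = _
  rw [RingQuot.liftAlgHom_mkAlgHom_apply, FreeAlgebra.lift_ι_apply, sharpGen]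

theorem sharp_Δ : sharp Δ = (1 / 64 : ℂ) • ((H + 2) * F ^ 2 - (H - 2) * E ^ 2) := by
  change RingQuot.liftAlgHom ℂ _ (RingQuot.mkAlgHom ℂ RacahFree.Rel RacahFree.Δ) = _
  rw [RingQuot.liftAlgHom_mkAlgHom_apply, FreeAlgebra.lift_ι_apply, sharpGen]

end Racah

/-! ### The pullback of a `U(sl₂)`-module along `♯` -/

/-- The `U(sl₂)`-module `V`, regarded as an `ℜ`-module via `♯`. -/
def SharpPullback (V : Type u) : Type u := V

namespace SharpPullback

instance instAddCommGroup (V : Type u) [AddCommGroup V] : AddCommGroup (SharpPullback V) := inferInstanceAs (AddCommGroup V)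

instance instModuleComplex (V : Type u) [AddCommGroup V] [Module ℂ V] :
    Module ℂ (SharpPullback V) := inferInstanceAs (Module ℂ V)

/-- `x ∈ ℜ` acts as `♯ x ∈ U(sl₂)`. -/
instance instModuleRacah (V : Type u) [AddCommGroup V] [Module USl2 V] :
    Module Racah (SharpPullback V) :=
  Module.compHom V Racah.sharp.toRingHom

instance instIsScalarTower (V : Type u) [AddCommGroup V] [Module ℂ V] [Module USl2 V]
    [IsScalarTower ℂ USl2 V] : IsScalarTower ℂ Racah (SharpPullback V) where
  smul_assoc c x v := by
    change (Racah.sharp (c • x) • (show V from v) : V) = c • (Racah.sharp x • (show V from v) : V)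
    rw [map_smul, smul_assoc]

end SharpPullback

/-! ### Complete reducibility -/

/-- An `R`-module is completely reducible if it is isomorphic to a direct sum of irreducible
`R`-modules. The empty direct sum is allowed, so the zero module is completely reducible. -/
def IsCompletelyReducible (R : Type) [Ring R] (M : Type u) [AddCommGroup M] [Module R M] : Prop :=
  ∃ (ι : Type u) (N : ι → Type u) (_ : ∀ i, AddCommGroup (N i)) (_ : ∀ i, Module R (N i)),
    (∀ i, IsSimpleModule R (N i)) ∧ Nonempty (M ≃ₗ[R] ⨁ i, N i)

/-! ### Leonard triples -/

/-- A square matrix is irreducible tridiagonal if its nonzero entries lie on the diagonal, the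
subdiagonal and the superdiagonal, and all entries on the subdiagonal and the superdiagonal are
nonzero. -/
def Matrix.IsIrreducibleTridiagonal {K : Type*} [Field K] {n : ℕ}
    (M : Matrix (Fin n) (Fin n) K) : Prop :=
  (∀ i j : Fin n, M i j ≠ 0 → (i : ℕ) = j ∨ (i : ℕ) = j + 1 ∨ (j : ℕ) = i + 1) ∧
    (∀ i j : Fin n, (i : ℕ) = j + 1 → M i j ≠ 0) ∧
    (∀ i j : Fin n, (j : ℕ) = i + 1 → M i j ≠ 0)

/-- There is a basis with respect to which `L₁` is diagonal and `L₂`, `L₃` are irreducible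
tridiagonal. -/
def HasLeonardBasis {K V : Type*} [Field K] [AddCommGroup V] [Module K V]
    (L₁ L₂ L₃ : V →ₗ[K] V) : Prop :=
  ∃ (n : ℕ) (b : Module.Basis (Fin n) K V),
    (LinearMap.toMatrix b b L₁).IsDiag ∧
    (LinearMap.toMatrix b b L₂).IsIrreducibleTridiagonal ∧
    (LinearMap.toMatrix b b L₃).IsIrreducibleTridiagonal

/-- Leonard triples on a vector space of finite positive dimension. -/
structure IsLeonardTriple {K V : Type*} [Field K] [AddCommGroup V] [Module K V]
    (L₁ L₂ L₃ : V →ₗ[K] V) : Prop where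
  finiteDimensional : FiniteDimensional K V
  nontrivial : Nontrivial V
  diag₁ : HasLeonardBasis L₁ L₂ L₃
  diag₂ : HasLeonardBasis L₂ L₃ L₁
  diag₃ : HasLeonardBasis L₃ L₁ L₂

end

/-! Let `a` be a highest weight vector of weight n and u_k = f^k a / k!. Up to scalars and additive
constants, B acts as h², and A, C act as (e ± f)² = e² + f² ± (ef + fe). On the string, h² and ef +
fe are diagonal, while e² + f² moves k by ±2, so the parity of k is preserved. The B-eigenvalues of
u_k and u_l coincide only if l = k or l = n - k. For n odd, this reflection exchanges the parities,
so each parity class is a chain with distinct B-eigenvalues. For n even it preserves them, and the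
chains consist of u_k ± u_{n-k} with k ≤ n/2; e² + f² respects these because the reflection
interchanges the roles of e and f.

On each chain B is diagonal with simple spectrum and A, C are irreducible tridiagonal
(`foldedString_mem`). A nonzero invariant subspace of the span contains some chain vector, then its
neighbours, then all of them (`eq_top_of_chain`), so the span is simple.

Strings of highest and of lowest weight vectors span V (`eq_top_of_strings`). Hence V is a sum of
simple submodules with a Leonard basis diagonalising B; it is semisimple, and every simple submodule
is isomorphic to one of these. The bases diagonalising A and C come from the cyclic symmetry of e +
f, i(e - f), h (`rotate`). -/

/-! ### Finite-dimensional representations of sl₂: spanning by strings. -/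

/-- Three operators satisfying the defining relations of `sl₂`. Unlike `IsSl2Triple`, the zero
triple is allowed. -/
structure Sl2Operators {V : Type*} [AddCommGroup V] [Module ℂ V] (e f h : Module.End ℂ V) :
    Prop where
  e_f : ∀ v, e (f v) = f (e v) + h v
  h_e : ∀ v, h (e v) = e (h v) + (2 : ℂ) • e v
  h_f : ∀ v, h (f v) = f (h v) - (2 : ℂ) • f v

namespace Sl2Operators

variable {V : Type*} [AddCommGroup V] [Module ℂ V] {e f h : Module.End ℂ V}

theorem swap (t : Sl2Operators e f h) : Sl2Operators f e (-h) where
  e_f v := by rw [t.e_f]; simp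
  h_e v := by simp only [LinearMap.neg_apply, t.h_f, map_neg]; module
  h_f v := by simp only [LinearMap.neg_apply, t.h_e, map_neg]; module

theorem h_f_pow (t : Sl2Operators e f h) (k : ℕ) (v : V) :
    h ((f ^ k) v) = (f ^ k) (h v) - (2 * k : ℂ) • (f ^ k) v := by
  induction k with
  | zero => simp
  | succ k ih =>
    rw [pow_succ', Module.End.mul_apply, Module.End.mul_apply, t.h_f, ih]
    simp only [map_sub, map_smul]
    push_cast
    module

theorem h_e_pow (t : Sl2Operators e f h) (k : ℕ) (v : V) :
    h ((e ^ k) v) = (e ^ k) (h v) + (2 * k : ℂ) • (e ^ k) v := by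
  have := t.swap.h_f_pow k v
  simp only [LinearMap.neg_apply, map_neg] at this
  rw [← neg_inj, this]
  module

theorem e_f_pow_succ (t : Sl2Operators e f h) {v : V} (hv : e v = 0) (k : ℕ) :
    e ((f ^ (k + 1)) v) = ((k : ℂ) + 1) • (f ^ k) (h v - (k : ℂ) • v) := by
  induction k with
  | zero => simp [t.e_f, hv]
  | succ k ih =>
    rw [pow_succ', Module.End.mul_apply, t.e_f, ih, t.h_f_pow, map_smul,
      ← Module.End.mul_apply, ← pow_succ']
    simp only [map_sub, map_smul]
    push_cast
    module

/-- Otherwise the powers of f would be eigenvectors of ad h for the distinct eigenvalues -2k, giving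
infinitely many independent elements of End V. -/
theorem f_nilpotent [FiniteDimensional ℂ V] (t : Sl2Operators e f h) : ∃ N, f ^ N = 0 := by
  by_contra! hf
  let ad : Module.End ℂ (Module.End ℂ V) := LinearMap.mulLeft ℂ h - LinearMap.mulRight ℂ h
  have hinj : Function.Injective (fun k : ℕ ↦ (-2 * k : ℂ)) := fun a b hab ↦ by
    simpa using hab
  have := Module.End.eigenvectors_linearIndependent' ad (fun k : ℕ ↦ (-2 * k : ℂ)) hinj
    (fun k ↦ f ^ k) fun k ↦ by
      refine Module.End.hasEigenvector_iff.2 ⟨Module.End.mem_eigenspace_iff.2 ?_, hf k⟩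
      ext v
      simp only [ad, LinearMap.sub_apply, LinearMap.mulLeft_apply, LinearMap.mulRight_apply,
        Module.End.mul_apply, LinearMap.smul_apply, t.h_f_pow]
      module
  have := this.finite
  exact not_finite ℕ

/-- The weight of a highest weight vector is a natural number. -/
theorem exists_nat [FiniteDimensional ℂ V] (t : Sl2Operators e f h) {v : V} {μ : ℂ}
    (hv : v ≠ 0) (he : e v = 0) (hh : h v = μ • v) : ∃ n : ℕ, μ = n := by
  obtain ⟨N, hN⟩ := t.f_nilpotent
  -- Choose n with f^n v ≠ 0 = f^(n+1) v; then 0 = e f^(n+1) v = (n+1)(μ - n) f^n v.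
  obtain ⟨n, hn₁, hn₂⟩ := Nat.exists_not_and_succ_of_not_zero_of_exists
    (p := fun k ↦ (f ^ k) v = 0) (by simpa using hv) ⟨N, by simp [hN]⟩
  refine ⟨n, ?_⟩
  have h1 := t.e_f_pow_succ he n
  rw [hn₂, map_zero, hh, ← sub_smul, map_smul, smul_smul] at h1
  have h2 := (smul_eq_zero.1 h1.symm).resolve_right hn₁
  rcases mul_eq_zero.1 h2 with h3 | h3
  · exact absurd h3 (Nat.cast_add_one_ne_zero n)
  · exact sub_eq_zero.1 h3

/-- Otherwise this is a highest weight vector of weight -n - 2, against `exists_nat`. -/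
theorem f_pow_eq_zero [FiniteDimensional ℂ V] (t : Sl2Operators e f h) {v : V} {n : ℕ}
    (he : e v = 0) (hh : h v = (n : ℂ) • v) : (f ^ (n + 1)) v = 0 := by
  by_contra hv
  obtain ⟨m, hm⟩ := t.exists_nat (μ := n - 2 * (n + 1)) hv
    (by rw [t.e_f_pow_succ he, hh]; simp)
    (by rw [t.h_f_pow, hh, map_smul]; push_cast; module)
  have : ((m + n + 2 : ℕ) : ℂ) = 0 := by push_cast; linear_combination -hm
  exact absurd (Nat.cast_eq_zero.1 this) (by omega)

/-- If y = hv - μv ≠ 0, then y is a highest weight vector, so μ = n is natural and f^k y = 0 exactly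
for k > n. Now e f^(k+1) v = (k+1) f^k (y + (n-k) v). At k = n the right side is a nonzero multiple
of f^n y, and for k > n it is a nonzero multiple of f^k v. So f^k v ≠ 0 for all k > n, contradicting
nilpotency. -/
theorem h_eq_of_sq [FiniteDimensional ℂ V] (t : Sl2Operators e f h) {v : V} {μ : ℂ}
    (he : e v = 0) (hv : h (h v - μ • v) = μ • (h v - μ • v)) : h v = μ • v := by
  by_contra hne
  have hy : h v - μ • v ≠ 0 := sub_ne_zero.2 hne
  have hey : e (h v - μ • v) = 0 := by
    have := t.h_e v
    simp only [he, map_zero, smul_zero, add_zero] at this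
    simp [← this, he]
  obtain ⟨n, rfl⟩ := t.exists_nat hy hey hv
  have hfy : ∀ j, (f ^ (n + 1 + j)) (h v - (n : ℂ) • v) = 0 := fun j ↦ by
    rw [add_comm, pow_add, Module.End.mul_apply, t.f_pow_eq_zero hey hv, map_zero]
  have key : ∀ j, (f ^ (n + 1 + j)) v ≠ 0 := by
    intro j
    induction j with
    | zero =>
      intro h0
      have h1 := t.e_f_pow_succ he n
      rw [add_zero] at h0
      rw [h0, map_zero] at h1
      have h2 := (smul_eq_zero.1 h1.symm).resolve_left (Nat.cast_add_one_ne_zero n)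
      have h3 : ∀ i ≤ n, (f ^ i) (h v - (n : ℂ) • v) ≠ 0 := by
        intro i
        induction i with
        | zero => intro _; simpa using hy
        | succ i ih =>
          intro hi h4
          have h5 := t.e_f_pow_succ hey i
          rw [h4, hv, map_zero, ← sub_smul, map_smul, smul_smul] at h5
          rcases mul_eq_zero.1 ((smul_eq_zero.1 h5.symm).resolve_right (ih (by omega))) with h6 | h6
          · exact absurd h6 (Nat.cast_add_one_ne_zero i)
          · have := Nat.cast_inj.1 (sub_eq_zero.1 h6)
            omega
      exact h3 n le_rfl h2
    | succ j ih =>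
      intro h0
      have h1 := t.e_f_pow_succ he (n + 1 + j)
      rw [add_assoc (n + 1) j 1, h0, map_zero,
        show h v - ((n + 1 + j : ℕ) : ℂ) • v = (h v - (n : ℂ) • v) - ((1 + j : ℕ) : ℂ) • v by
          push_cast; module, map_sub, hfy, map_smul, zero_sub, smul_neg, eq_comm, neg_eq_zero,
        smul_smul] at h1
      refine (smul_ne_zero (mul_ne_zero (Nat.cast_add_one_ne_zero _) ?_) ih) h1
      exact Nat.cast_ne_zero.2 (by omega)
  obtain ⟨N, hN⟩ := t.f_nilpotent
  refine key N ?_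
  rw [pow_add, hN, mul_zero, LinearMap.zero_apply]

/-- `h` acts semisimply on the kernel of `e`. -/
theorem h_eq_of_pow [FiniteDimensional ℂ V] (t : Sl2Operators e f h) {μ : ℂ} (r : ℕ) :
    ∀ {v : V}, e v = 0 → ((h - μ • 1) ^ r) v = 0 → h v = μ • v := by
  induction r with
  | zero => intro v _ hv; obtain rfl : v = 0 := by simpa using hv
            simp
  | succ r ih =>
    intro v he hv
    rw [pow_succ, Module.End.mul_apply] at hv
    have hey : e (h v - μ • v) = 0 := by
      have := t.h_e v
      simp only [he, map_zero, smul_zero, add_zero] at this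
      simp [← this, he]
    exact t.h_eq_of_sq he (ih hey (by simpa using hv))

theorem e_pow_mem_genEigen (t : Sl2Operators e f h) {μ : ℂ} {r : ℕ} {v : V}
    (hv : ((h - μ • 1) ^ r) v = 0) (k : ℕ) : ((h - (μ + 2 * k) • 1) ^ r) ((e ^ k) v) = 0 := by
  have : SemiconjBy (e ^ k) (h - μ • 1) (h - (μ + 2 * k) • 1) := by
    ext v
    simp only [Module.End.mul_apply, LinearMap.sub_apply, LinearMap.smul_apply,
      Module.End.one_apply, map_sub, map_smul, t.h_e_pow]
    module
  have h1 := LinearMap.congr_fun (this.pow_right r) v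
  rw [Module.End.mul_apply, Module.End.mul_apply, hv, map_zero] at h1
  exact h1.symm

theorem e_pow_f_pow (t : Sl2Operators e f h) {v : V} {μ : ℂ} (he : e v = 0)
    (hh : h v = μ • v) (k : ℕ) :
    (e ^ k) ((f ^ k) v) = (∏ i ∈ Finset.range k, (((i : ℂ) + 1) * (μ - i))) • v := by
  induction k with
  | zero => simp
  | succ k ih =>
    rw [pow_succ e, Module.End.mul_apply, t.e_f_pow_succ he, hh, ← sub_smul, map_smul,
      map_smul, map_smul, ih, smul_smul, smul_smul, Finset.prod_range_succ]
    congr 1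
    ring

/-- Induction on k: e^k v is a highest weight vector, and subtracting a suitable multiple of f^k e^k
v from v leaves a vector killed by e^k. The exponent r + 1 is positive so that the subtracted
eigenvector stays in the same kernel. -/
theorem mem_of_weight_nonneg [FiniteDimensional ℂ V] (t : Sl2Operators e f h)
    {S : Submodule ℂ V}
    (hS : ∀ (n : ℕ) (a : V), e a = 0 → h a = (n : ℂ) • a → ∀ k, (f ^ k) a ∈ S)
    (m r k : ℕ) : ∀ v : V, ((h - (m : ℂ) • 1) ^ (r + 1)) v = 0 → (e ^ k) v = 0 → v ∈ S := by
  induction k with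
  | zero => intro v _ hv; obtain rfl : v = 0 := by simpa using hv
            exact S.zero_mem
  | succ k ih =>
    intro v hv hk
    rw [pow_succ', Module.End.mul_apply] at hk
    have ha := t.h_eq_of_pow (r + 1) hk (t.e_pow_mem_genEigen hv k)
    set a := (e ^ k) v with ha_def
    set c : ℂ := ∏ i ∈ Finset.range k, (((i : ℂ) + 1) * (((m : ℂ) + 2 * k) - i)) with hc_def
    -- This is where the weight must be nonnegative: m + 2k - i > 0 for i < k.
    have hc : c ≠ 0 := Finset.prod_ne_zero_iff.2 fun i hi ↦ by
      have hi := Finset.mem_range.1 hi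
      refine mul_ne_zero (Nat.cast_add_one_ne_zero i) ?_
      rw [show ((m : ℂ) + 2 * k) - i = ((m + 2 * k - i : ℕ) : ℂ) by
        rw [Nat.cast_sub (by omega)]; push_cast; ring]
      exact Nat.cast_ne_zero.2 (by omega)
    have hmem : (f ^ k) a ∈ S := hS (m + 2 * k) a hk (by rw [ha]; push_cast; rfl) k
    have h1 : v - c⁻¹ • (f ^ k) a ∈ S := by
      refine ih _ ?_ ?_
      · rw [map_sub, hv, map_smul, pow_succ, Module.End.mul_apply]
        have : (h - (m : ℂ) • 1) ((f ^ k) a) = 0 := by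
          simp only [LinearMap.sub_apply, LinearMap.smul_apply, Module.End.one_apply, t.h_f_pow, ha,
            map_smul]
          module
        simp [this]
      · rw [map_sub, map_smul, t.e_pow_f_pow hk ha, ← hc_def, smul_smul, inv_mul_cancel₀ hc,
          one_smul, ← ha_def, sub_self]
    simpa using S.add_mem h1 (S.smul_mem c⁻¹ hmem)

/-- Weyl's theorem for `sl₂`, in the form: a finite-dimensional representation is spanned by the
strings of its highest weight vectors and of its lowest weight vectors. -/
theorem eq_top_of_strings [FiniteDimensional ℂ V] (t : Sl2Operators e f h)
    {S : Submodule ℂ V}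
    (hS : ∀ (n : ℕ) (a : V), e a = 0 → h a = (n : ℂ) • a → ∀ k, (f ^ k) a ∈ S)
    (hS' : ∀ (n : ℕ) (b : V), f b = 0 → (-h) b = (n : ℂ) • b → ∀ k, (e ^ k) b ∈ S) : S = ⊤ := by
  rw [eq_top_iff, ← Module.End.iSup_maxGenEigenspace_eq_top h]
  refine iSup_le fun μ v hv ↦ ?_
  obtain ⟨r, hr⟩ := Module.End.mem_maxGenEigenspace h μ v |>.1 hv
  by_cases hv0 : v = 0
  · exact hv0 ▸ S.zero_mem
  obtain ⟨N, hN⟩ := t.swap.f_nilpotent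
  obtain ⟨M, hM⟩ := t.f_nilpotent
  obtain ⟨k, hk₁, hk₂⟩ := Nat.exists_not_and_succ_of_not_zero_of_exists
    (p := fun k ↦ (e ^ k) v = 0) (by simpa using hv0) ⟨N, by simp [hN]⟩
  rw [pow_succ', Module.End.mul_apply] at hk₂
  obtain ⟨n, hn⟩ := t.exists_nat hk₁ hk₂ (t.h_eq_of_pow r hk₂ (t.e_pow_mem_genEigen hr k))
  -- The weight is the integer μ = n - 2k; negative weights become positive after exchanging e and
  -- f.
  rcases le_total (2 * k) n with hkn | hkn
  · refine t.mem_of_weight_nonneg hS (n - 2 * k) r N v ?_ (by simp [hN])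
    rw [show ((n - 2 * k : ℕ) : ℂ) = μ by rw [Nat.cast_sub hkn, ← hn]; push_cast; ring, pow_succ',
      Module.End.mul_apply, hr, map_zero]
  · refine t.swap.mem_of_weight_nonneg hS' (2 * k - n) r M v ?_ (by simp [hM])
    rw [show -h - ((2 * k - n : ℕ) : ℂ) • (1 : Module.End ℂ V) = -(h - μ • 1) by
      rw [Nat.cast_sub hkn, ← hn]; push_cast; module, neg_pow, pow_succ' (h - μ • 1)]
    simp [hr]

end Sl2Operators

/-! ### Chains of eigenvectors with irreducible tridiagonal operators. -/

/-- `L` acts on the sequence `w 0, …, w d` as an irreducible tridiagonal matrix. -/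
def TridiagonalOn {M : Type*} [AddCommGroup M] [Module ℂ M] (L : M →ₗ[ℂ] M) (w : ℕ → M) (d : ℕ) :
    Prop :=
  ∃ p q r : ℕ → ℂ, p 0 = 0 ∧ r d = 0 ∧ (∀ i < d, p (i + 1) ≠ 0 ∧ r i ≠ 0) ∧
    ∀ i ≤ d, L (w i) = p i • w (i - 1) + q i • w i + r i • w (i + 1)

/-- Every `L`-eigencomponent of a vector of an `L`-stable subspace lies in the subspace. -/
theorem mem_of_sum_mem {M ι : Type*} [AddCommGroup M] [Module ℂ M] {L : M →ₗ[ℂ] M}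
    {U : Submodule ℂ M} (hU : ∀ x ∈ U, L x ∈ U) {w : ι → M} {θ : ι → ℂ} {s : Finset ι}
    (hθ : Set.InjOn θ s) (hw : ∀ i ∈ s, L (w i) = θ i • w i) {c : ι → ℂ}
    (hx : ∑ i ∈ s, c i • w i ∈ U) {i : ι} (hi : i ∈ s) (hc : c i ≠ 0) : w i ∈ U := by
  classical
  -- Up to a nonzero factor, p(L) is the projection onto the eigencomponent of `w i`.
  let p : Polynomial ℂ := ∏ j ∈ s.erase i, (Polynomial.X - Polynomial.C (θ j))
  have hp : ∀ k ∈ s, Polynomial.aeval L p (w k) = p.eval (θ k) • w k := fun k hk ↦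
    Module.End.aeval_apply_of_mem_apply_eq_smul (hw k hk)
  have hpU : ∀ (g : Polynomial ℂ), ∀ x ∈ U, Polynomial.aeval L g x ∈ U := fun g ↦ by
    induction g using Polynomial.induction_on' with
    | add a b ha hb => exact fun x hx ↦ by simpa using U.add_mem (ha x hx) (hb x hx)
    | monomial n a =>
      intro x hx
      rw [Polynomial.aeval_monomial, Module.End.mul_apply]
      have : ∀ n : ℕ, (L ^ n) x ∈ U := fun n ↦ by
        induction n with
        | zero => simpa using hx
        | succ n ih => rw [pow_succ', Module.End.mul_apply]; exact hU _ ih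
      simpa using U.smul_mem a (this n)
  have h1 := hpU p _ hx
  rw [map_sum, Finset.sum_eq_single i] at h1
  · rw [map_smul, hp i hi, smul_smul] at h1
    refine (U.smul_mem_iff (mul_ne_zero hc ?_)).1 h1
    rw [Polynomial.eval_prod]
    refine Finset.prod_ne_zero_iff.2 fun j hj ↦ ?_
    have hj := Finset.mem_erase.1 hj
    simpa using sub_ne_zero.2 fun h ↦ hj.1 (hθ hi hj.2 h).symm
  · intro j hj hji
    have : p.eval (θ j) = 0 := by
      rw [Polynomial.eval_prod]
      exact Finset.prod_eq_zero (Finset.mem_erase.2 ⟨hji, hj⟩) (by simp)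
    rw [map_smul, hp j hj, this, zero_smul, smul_zero]
  · exact fun h ↦ absurd hi h

section Chain

variable {N : Type*} [AddCommGroup N] [Module ℂ N] {L₁ L₂ L₃ : N →ₗ[ℂ] N} {w : ℕ → N} {d : ℕ}
  {θ : ℕ → ℂ}

theorem TridiagonalOn.isIrreducibleTridiagonal (h : TridiagonalOn L₁ w d)
    (b : Module.Basis (Fin (d + 1)) ℂ N) (hb : ∀ i : Fin (d + 1), b i = w i) :
    (LinearMap.toMatrix b b L₁).IsIrreducibleTridiagonal := by
  obtain ⟨p, q, r, hp, hr, hpr, hL⟩ := h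
  have hrepr : ∀ k ≤ d, ∀ i : Fin (d + 1), b.repr (w k) i = if (i : ℕ) = k then 1 else 0 := by
    intro k hk i
    rw [show w k = b ⟨k, by omega⟩ from (hb ⟨k, by omega⟩).symm, b.repr_self, Finsupp.single_apply]
    simp only [Fin.ext_iff, eq_comm]
  have key : ∀ i j : Fin (d + 1), LinearMap.toMatrix b b L₁ i j =
      (if (j : ℕ) = i + 1 then p j else 0) + (if (i : ℕ) = j then q j else 0) +
        (if (i : ℕ) = j + 1 then r j else 0) := by
    intro i j
    have hj : (j : ℕ) ≤ d := Nat.lt_succ_iff.1 j.2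
    rw [LinearMap.toMatrix_apply, hb, hL j hj]
    simp only [map_add, map_smul, Finsupp.add_apply, Finsupp.smul_apply, smul_eq_mul,
      hrepr _ hj, mul_ite, mul_one, mul_zero]
    congr 1
    · congr 1
      -- For j = 0 truncated subtraction turns `w (j - 1)` into `w 0`; `p 0 = 0` discards it, as `r
      -- d = 0` discards `w (d + 1)` below.
      rcases Nat.eq_zero_or_pos (j : ℕ) with h0 | h0
      · simp [h0, hp]
      · rw [hrepr _ (by omega)]
        by_cases h1 : (j : ℕ) = i + 1
        · simp [h1]
        · rw [if_neg h1, if_neg (by omega), mul_zero]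
    · rcases hj.lt_or_eq with h1 | h1
      · rw [hrepr _ h1]; simp
      · have := i.2
        rw [if_neg (by omega), h1, hr, zero_mul]
  refine ⟨fun i j hij ↦ ?_, fun i j hij ↦ ?_, fun i j hij ↦ ?_⟩
  · by_contra! hc
    rw [key, if_neg hc.2.2, if_neg hc.1, if_neg hc.2.1] at hij
    simp at hij
  · rw [key, if_neg (by omega), if_neg (by omega), if_pos hij]
    simpa using (hpr j (by omega)).2
  · rw [key, if_pos hij, if_neg (by omega), if_neg (by omega), hij]
    simpa using (hpr i (by omega)).1

theorem hasLeonardBasis_of_chain (hw : ∀ i ≤ d, w i ≠ 0)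
    (hspan : Submodule.span ℂ (w '' Set.Iic d) = ⊤) (hθ : Set.InjOn θ (Set.Iic d))
    (h₁ : ∀ i ≤ d, L₁ (w i) = θ i • w i) (h₂ : TridiagonalOn L₂ w d)
    (h₃ : TridiagonalOn L₃ w d) : HasLeonardBasis L₁ L₂ L₃ := by
  have hle : ∀ i : Fin (d + 1), (i : ℕ) ≤ d := fun i ↦ Nat.lt_succ_iff.1 i.2
  have hli : LinearIndependent ℂ (fun i : Fin (d + 1) ↦ w i) :=
    Module.End.eigenvectors_linearIndependent' L₁ (fun i : Fin (d + 1) ↦ θ i)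
      (fun i j hij ↦ Fin.ext (hθ (hle i) (hle j) hij)) _ fun i ↦
        Module.End.hasEigenvector_iff.2
          ⟨Module.End.mem_eigenspace_iff.2 (h₁ i (hle i)), hw i (hle i)⟩
  have hrange : Set.range (fun i : Fin (d + 1) ↦ w i) = w '' Set.Iic d := by
    ext x
    constructor
    · rintro ⟨i, rfl⟩
      exact ⟨i, hle i, rfl⟩
    · rintro ⟨i, hi, rfl⟩
      exact ⟨⟨i, Nat.lt_succ_iff.2 hi⟩, rfl⟩
  let b := Module.Basis.mk hli (by rw [hrange, hspan])
  have hb : ∀ i, b i = w i := fun i ↦ by simp [b]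
  refine ⟨d + 1, b, fun i j hij ↦ ?_, h₂.isIrreducibleTridiagonal b hb,
    h₃.isIrreducibleTridiagonal b hb⟩
  change LinearMap.toMatrix b b L₁ i j = 0
  rw [LinearMap.toMatrix_apply, hb, h₁ j (hle j), ← hb, map_smul, b.repr_self]
  simp [hij.symm]

/-- A nonzero subspace stable under `L₁` and `L₂` is everything. -/
theorem eq_top_of_chain {U : Submodule ℂ N}
    (hspan : Submodule.span ℂ (w '' Set.Iic d) = ⊤) (hθ : Set.InjOn θ (Set.Iic d))
    (h₁ : ∀ i ≤ d, L₁ (w i) = θ i • w i) (h₂ : TridiagonalOn L₂ w d)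
    (hU₁ : ∀ x ∈ U, L₁ x ∈ U) (hU₂ : ∀ x ∈ U, L₂ x ∈ U) (hU : U ≠ ⊥) : U = ⊤ := by
  have hset : (Set.Iic d) = ((Finset.range (d + 1) : Finset ℕ) : Set ℕ) := by
    ext; simp
  rw [hset] at hθ
  have h₁' : ∀ i ∈ Finset.range (d + 1), L₁ (w i) = θ i • w i := fun i hi ↦
    h₁ i (Nat.lt_succ_iff.1 (Finset.mem_range.1 hi))
  have start : ∃ i ≤ d, w i ∈ U := by
    obtain ⟨x, hxU, hx0⟩ := (Submodule.ne_bot_iff U).1 hU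
    have hx : x ∈ Submodule.span ℂ (w '' ((Finset.range (d + 1) : Finset ℕ) : Set ℕ)) := by
      rw [← hset, hspan]; trivial
    obtain ⟨c, rfl⟩ := (Submodule.mem_span_image_finset_iff_exists_fun ℂ).1 hx
    obtain ⟨i, hi, hci⟩ := Finset.exists_ne_zero_of_sum_ne_zero hx0
    exact ⟨i, Nat.lt_succ_iff.1 (Finset.mem_range.1 i.2),
      mem_of_sum_mem (w := fun i : Finset.range (d + 1) ↦ w i) (θ := fun i ↦ θ i) (c := c)
        hU₁ (fun a _ b _ hab ↦ Subtype.ext (hθ a.2 b.2 hab))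
        (fun i _ ↦ h₁' i i.2) hxU hi fun h ↦ hci (by rw [h, zero_smul])⟩
  obtain ⟨p, q, r, hp, hr, hpr, hL⟩ := h₂
  have step : ∀ i ≤ d, w i ∈ U → ∀ j ≤ d, (j = i + 1 ∨ i = j + 1) → w j ∈ U := by
    intro i hi hiU j hj hij
    classical
    -- The coefficients of `L₂ (w i)` along the chain; they are nonzero at both neighbours of i, so
    -- each neighbour's eigencomponent lies in U.
    let c : ℕ → ℂ := fun k ↦ (if k + 1 = i then p i else 0) + (if k = i then q i else 0) +
      (if k = i + 1 then r i else 0)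
    have hsum : ∑ k ∈ Finset.range (d + 1), c k • w k ∈ U := by
      have : ∑ k ∈ Finset.range (d + 1), c k • w k = L₂ (w i) := by
        rw [hL i hi]
        simp only [c, add_smul, Finset.sum_add_distrib]
        congr 1
        · congr 1
          · rcases Nat.eq_zero_or_pos i with h0 | h0
            · subst h0; simp [hp]
            · rw [Finset.sum_eq_single (i - 1)]
              · rw [if_pos (by omega)]
              · intro k _ hk
                rw [if_neg (by omega), zero_smul]
              · intro hk
                exact absurd (Finset.mem_range.2 (by omega)) hk
          · rw [Finset.sum_eq_single i]
            · simp
            · intro k _ hk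
              rw [if_neg hk, zero_smul]
            · intro hk
              exact absurd (Finset.mem_range.2 (by omega)) hk
        · rw [Finset.sum_eq_single (i + 1)]
          · simp
          · intro k _ hk
            rw [if_neg hk, zero_smul]
          · intro hk
            have : i = d := by simp at hk; omega
            simp [this, hr]
      rw [this]
      exact hU₂ _ hiU
    refine mem_of_sum_mem hU₁ hθ h₁' hsum (Finset.mem_range.2 (by omega)) ?_
    rcases hij with rfl | rfl
    · have : i + 1 + 1 ≠ i := by omega
      simpa [c, this] using (hpr i (by omega)).2
    · have : j ≠ j + 1 + 1 := by omega
      simpa [c, this] using (hpr j (by omega)).1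
  obtain ⟨i₀, hi₀, hi₀U⟩ := start
  have up : ∀ k, i₀ + k ≤ d → w (i₀ + k) ∈ U := fun k ↦ by
    induction k with
    | zero => exact fun _ ↦ hi₀U
    | succ k ih => exact fun hk ↦ step _ (by omega) (ih (by omega)) _ hk (Or.inl rfl)
  have down : ∀ k ≤ i₀, w (i₀ - k) ∈ U := fun k ↦ by
    induction k with
    | zero => exact fun _ ↦ hi₀U
    | succ k ih => exact fun hk ↦ step _ (by omega) (ih (by omega)) _ (by omega) (Or.inr (by omega))
  rw [eq_top_iff, ← hspan, Submodule.span_le]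
  rintro _ ⟨i, hi, rfl⟩
  have hi : i ≤ d := hi
  rcases le_total i₀ i with h | h
  · obtain ⟨k, rfl⟩ := Nat.exists_eq_add_of_le h
    exact up k hi
  · have := down (i₀ - i) (by omega)
    rwa [Nat.sub_sub_self h] at this

end Chain

/-! ### Simple modules spanned by chains. -/

section Modules

variable {R : Type*} [Ring R] [Algebra ℂ R] (A B C : R)
  (M : Type*) [AddCommGroup M] [Module ℂ M] [Module R M] [IsScalarTower ℂ R M]

/-- The simple submodules on which `B` is diagonalised by a basis making `C`, `A` irreducible
tridiagonal. -/
def leonardSimples : Set (Submodule R M) :=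
  {S | IsSimpleModule R S ∧ HasLeonardBasis (Algebra.lsmul ℂ ℂ S B) (Algebra.lsmul ℂ ℂ S C)
    (Algebra.lsmul ℂ ℂ S A)}

variable {A B C M}

theorem TridiagonalOn.restrict {S : Submodule R M} {x : R} {w : ℕ → M} {d : ℕ}
    (h : TridiagonalOn (Algebra.lsmul ℂ ℂ M x) w d) {w' : ℕ → S} (hw' : ∀ i ≤ d, (w' i : M) = w i) :
    TridiagonalOn (Algebra.lsmul ℂ ℂ S x) w' d := by
  obtain ⟨p, q, r, hp, hr, hpr, hL⟩ := h
  refine ⟨p, q, r, hp, hr, hpr, fun i hi ↦ Subtype.ext ?_⟩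
  have := hL i hi
  simp only [Algebra.lsmul_apply] at this
  simp only [Algebra.lsmul_apply, Submodule.coe_smul, Submodule.coe_add, Submodule.coe_smul_of_tower,
    hw' i hi, hw' (i - 1) (by omega), this]
  -- Nothing relates `w' (d + 1)` to `w (d + 1)`, but both have coefficient `r d = 0`.
  rcases hi.lt_or_eq with h1 | h1
  · rw [hw' _ h1]
  · simp [h1, hr]

/-- The ℂ-span of the chain is stable under the generators A, B, C, hence is an R-submodule;
simplicity is `eq_top_of_chain` for B and C. -/
theorem mem_leonardSimples_of_chain (hR : Algebra.adjoin ℂ {A, B, C} = ⊤) {w : ℕ → M} {d : ℕ}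
    {θ : ℕ → ℂ} (hw : ∀ i ≤ d, w i ≠ 0) (hθ : Set.InjOn θ (Set.Iic d))
    (hB : ∀ i ≤ d, B • w i = θ i • w i) (hC : TridiagonalOn (Algebra.lsmul ℂ ℂ M C) w d)
    (hA : TridiagonalOn (Algebra.lsmul ℂ ℂ M A) w d) :
    ∃ S ∈ leonardSimples A B C M, ∀ i ≤ d, w i ∈ S := by
  set T := Submodule.span ℂ (w '' Set.Iic d) with hT
  have hwT : ∀ i ≤ d, w i ∈ T := fun i hi ↦ Submodule.subset_span ⟨i, hi, rfl⟩
  have htri : ∀ x : R, TridiagonalOn (Algebra.lsmul ℂ ℂ M x) w d → ∀ i ≤ d, x • w i ∈ T := by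
    rintro x ⟨p, q, r, hp, hr, hpr, hL⟩ i hi
    have := hL i hi
    rw [Algebra.lsmul_apply] at this
    rw [this]
    refine T.add_mem (T.add_mem (T.smul_mem _ (hwT _ (by omega))) (T.smul_mem _ (hwT _ hi))) ?_
    rcases hi.lt_or_eq with h1 | h1
    · exact T.smul_mem _ (hwT _ h1)
    · simp [h1, hr]
  have hgen : ∀ x ∈ ({A, B, C} : Set R), ∀ i ≤ d, x • w i ∈ T := by
    rintro x (rfl | rfl | rfl) i hi
    · exact htri _ hA i hi
    · rw [hB i hi]; exact T.smul_mem _ (hwT i hi)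
    · exact htri _ hC i hi
  have hsmul : ∀ x : R, ∀ v ∈ T, x • v ∈ T := by
    intro x
    have hx : x ∈ Algebra.adjoin ℂ {A, B, C} := hR ▸ Algebra.mem_top
    induction hx using Algebra.adjoin_induction with
    | mem x hx =>
      have : T ≤ T.comap (Algebra.lsmul ℂ ℂ M x) := by
        rw [hT, Submodule.span_le]
        rintro _ ⟨i, hi, rfl⟩
        exact hgen x hx i hi
      exact fun v hv ↦ this hv
    | algebraMap c => intro v hv; rw [algebraMap_smul]; exact T.smul_mem c hv
    | add x y _ _ hx hy => intro v hv; rw [add_smul]; exact T.add_mem (hx v hv) (hy v hv)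
    | mul x y _ _ hx hy => intro v hv; rw [mul_smul]; exact hx _ (hy v hv)
  let S : Submodule R M :=
    { carrier := T, add_mem' := T.add_mem, zero_mem' := T.zero_mem, smul_mem' := fun x v ↦ hsmul x v }
  let w' : ℕ → S := fun i ↦ if h : i ≤ d then ⟨w i, hwT i h⟩ else 0
  have hw' : ∀ i ≤ d, (w' i : M) = w i := fun i hi ↦ by simp [w', hi]
  have hw'0 : ∀ i ≤ d, w' i ≠ 0 := fun i hi h0 ↦ hw i hi (by rw [← hw' i hi, h0]; rfl)
  have hspan : Submodule.span ℂ (w' '' Set.Iic d) = ⊤ := by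
    let ι : S →ₗ[ℂ] M := S.subtype.restrictScalars ℂ
    have hι : Function.Injective ι := Subtype.val_injective
    refine Submodule.map_injective_of_injective hι ?_
    rw [Submodule.map_span, ← Set.image_comp, Submodule.map_top]
    have : (ι ∘ w') '' Set.Iic d = w '' Set.Iic d := Set.image_congr fun i hi ↦ hw' i hi
    rw [this]
    ext x
    exact ⟨fun hx ↦ ⟨⟨x, hx⟩, rfl⟩, fun ⟨y, hy⟩ ↦ hy ▸ y.2⟩
  have hB' : ∀ i ≤ d, Algebra.lsmul ℂ ℂ S B (w' i) = θ i • w' i := fun i hi ↦ Subtype.ext <| by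
    simp only [Algebra.lsmul_apply, Submodule.coe_smul, hw' i hi, hB i hi]
  refine ⟨S, ⟨?_, hasLeonardBasis_of_chain hw'0 hspan hθ hB' (hC.restrict hw') (hA.restrict hw')⟩,
    hwT⟩
  have : Nontrivial S := ⟨⟨w' 0, 0, hw'0 0 (Nat.zero_le d)⟩⟩
  refine (isSimpleModule_iff R S).2 ⟨fun U ↦ or_iff_not_imp_left.2 fun hU ↦ ?_⟩
  have := eq_top_of_chain (U := U.restrictScalars ℂ) hspan hθ hB' (hC.restrict hw')
    (fun x hx ↦ U.smul_mem B hx) (fun x hx ↦ U.smul_mem C hx)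
    (fun h ↦ hU ((Submodule.restrictScalars_eq_bot_iff ..).1 h))
  exact (Submodule.restrictScalars_eq_top_iff ..).1 this

theorem HasLeonardBasis.congr {N N' : Type*} [AddCommGroup N] [Module ℂ N] [Module R N]
    [IsScalarTower ℂ R N] [AddCommGroup N'] [Module ℂ N'] [Module R N'] [IsScalarTower ℂ R N']
    (φ : N ≃ₗ[R] N') (h : HasLeonardBasis (Algebra.lsmul ℂ ℂ N A) (Algebra.lsmul ℂ ℂ N B)
      (Algebra.lsmul ℂ ℂ N C)) :
    HasLeonardBasis (Algebra.lsmul ℂ ℂ N' A) (Algebra.lsmul ℂ ℂ N' B) (Algebra.lsmul ℂ ℂ N' C) := by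
  obtain ⟨n, b, h₁, h₂, h₃⟩ := h
  let ψ : N ≃ₗ[ℂ] N' := φ.restrictScalars ℂ
  have hψ : ∀ (x : R) (v : N'), ψ.symm (x • v) = x • ψ.symm v := fun x v ↦ φ.symm.map_smul x v
  have key : ∀ x : R, LinearMap.toMatrix (b.map ψ) (b.map ψ) (Algebra.lsmul ℂ ℂ N' x) =
      LinearMap.toMatrix b b (Algebra.lsmul ℂ ℂ N x) := fun x ↦ by
    ext i j
    simp [LinearMap.toMatrix_apply, hψ]
  exact ⟨n, b.map ψ, by rwa [key], by rwa [key], by rwa [key]⟩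

theorem isSemisimpleModule_of_sSup_leonardSimples (h : sSup (leonardSimples A B C M) = ⊤) :
    IsSemisimpleModule R M :=
  .of_sSup_simples_eq_top (top_le_iff.1 (h ▸ sSup_le_sSup fun _ hS ↦ hS.1))

/-- A simple submodule of a sum of simple submodules is isomorphic to one of the summands, and
Leonard bases transport along isomorphisms. -/
theorem hasLeonardBasis_of_sSup_leonardSimples (h : sSup (leonardSimples A B C M) = ⊤)
    (W : Submodule R M) [IsSimpleModule R W] :
    HasLeonardBasis (Algebra.lsmul ℂ ℂ W B) (Algebra.lsmul ℂ ℂ W C) (Algebra.lsmul ℂ ℂ W A) := by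
  have : ∀ m : leonardSimples A B C M, IsSimpleModule R m := fun m ↦ m.2.1
  obtain ⟨S, hS, ⟨φ⟩⟩ := W.linearEquiv_of_sSup_eq_top _ h
  exact hS.2.congr φ.symm

end Modules

/-- Used with T = e² + f²: along a chain, A and C are ±T/16 plus diagonal terms. -/
theorem TridiagonalOn.of_smul_add {M : Type*} [AddCommGroup M] [Module ℂ M] {T L : M →ₗ[ℂ] M}
    {w : ℕ → M} {d : ℕ} (hT : TridiagonalOn T w d) {c : ℂ} (hc : c ≠ 0) {γ : ℕ → ℂ}
    (hL : ∀ i ≤ d, L (w i) = c • T (w i) + γ i • w i) : TridiagonalOn L w d := by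
  obtain ⟨p, q, r, hp, hr, hpr, h⟩ := hT
  refine ⟨fun i ↦ c * p i, fun i ↦ c * q i + γ i, fun i ↦ c * r i, by simp [hp], by simp [hr],
    fun i hi ↦ ⟨mul_ne_zero hc (hpr i hi).1, mul_ne_zero hc (hpr i hi).2⟩, fun i hi ↦ ?_⟩
  rw [hL i hi, h i hi]
  module

/-! ### Strings of highest weight vectors and their folding. -/

section String

variable {M : Type*} [AddCommGroup M] [Module ℂ M] {e f h : Module.End ℂ M} {a : M} {n : ℕ}

/-- The divided powers `f ^ k a / k!`, extended by zero to negative `k`. -/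
noncomputable def sl2String (f : Module.End ℂ M) (a : M) : ℤ → M
  | (k : ℕ) => ((k.factorial : ℂ)⁻¹) • (f ^ k) a
  | Int.negSucc _ => 0

theorem sl2String_of_neg {k : ℤ} (hk : k < 0) : sl2String f a k = 0 := by
  obtain ⟨m, rfl⟩ := Int.eq_negSucc_of_lt_zero hk
  rfl

theorem sl2String_natCast (k : ℕ) :
    sl2String f a k = ((k.factorial : ℂ)⁻¹) • (f ^ k) a := rfl

theorem f_sl2String (k : ℤ) : f (sl2String f a k) = ((k : ℂ) + 1) • sl2String f a (k + 1) := by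
  rcases k with k | k
  · have h1 : (Int.ofNat k : ℤ) + 1 = ((k + 1 : ℕ) : ℤ) := by simp
    have hk : ((k : ℂ) + 1) ≠ 0 := Nat.cast_add_one_ne_zero k
    rw [h1, Int.ofNat_eq_natCast, sl2String_natCast, sl2String_natCast, map_smul, smul_smul,
      ← Module.End.mul_apply, ← pow_succ', Nat.factorial_succ]
    congr 1
    push_cast
    field_simp
  · rw [sl2String_of_neg (Int.negSucc_lt_zero k), map_zero]
    -- At k = -1 the next vector is `a`, but the coefficient k + 1 vanishes.
    rcases k with _ | k
    · simp
    · rw [sl2String_of_neg (by omega), smul_zero]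

variable (t : Sl2Operators e f h) (he : e a = 0) (hh : h a = (n : ℂ) • a)

include t hh in
theorem Sl2Operators.h_sl2String (k : ℤ) :
    h (sl2String f a k) = ((n : ℂ) - 2 * k) • sl2String f a k := by
  rcases k with k | k
  · rw [Int.ofNat_eq_natCast, sl2String_natCast, map_smul, t.h_f_pow, hh, map_smul]
    push_cast
    module
  · rw [sl2String_of_neg (Int.negSucc_lt_zero k), map_zero, smul_zero]

include t he hh in
theorem Sl2Operators.e_sl2String (k : ℤ) :
    e (sl2String f a k) = ((n : ℂ) - k + 1) • sl2String f a (k - 1) := by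
  rcases k with k | k
  · rcases k with _ | k
    · rw [Int.ofNat_eq_natCast, sl2String_natCast, sl2String_of_neg (by simp)]
      simp [he]
    · have h1 : (Int.ofNat (k + 1) : ℤ) - 1 = ((k : ℕ) : ℤ) := by simp
      have hk : ((k : ℂ) + 1) ≠ 0 := Nat.cast_add_one_ne_zero k
      rw [h1, Int.ofNat_eq_natCast, sl2String_natCast, sl2String_natCast, map_smul,
        t.e_f_pow_succ he, hh, ← sub_smul, map_smul, smul_smul, smul_smul, smul_smul,
        Nat.factorial_succ]
      congr 1
      push_cast
      field_simp
      ring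
  · rw [sl2String_of_neg (Int.negSucc_lt_zero k), map_zero, sl2String_of_neg (by omega), smul_zero]

include t he hh in
theorem Sl2Operators.sl2String_of_gt [FiniteDimensional ℂ M] {k : ℤ} (hk : n < k) :
    sl2String f a k = 0 := by
  obtain ⟨m, rfl⟩ : ∃ m : ℕ, k = ((m + (n + 1) : ℕ) : ℤ) := ⟨(k - n - 1).toNat, by omega⟩
  rw [sl2String_natCast, pow_add, Module.End.mul_apply, t.f_pow_eq_zero he hh, map_zero, smul_zero]

include t he hh in
-- By induction, since e sends u_{k+1} to (n - k) u_k with n - k ≠ 0.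
theorem Sl2Operators.sl2String_ne_zero (ha : a ≠ 0) {k : ℤ} (hk : 0 ≤ k) (hkn : k ≤ n) :
    sl2String f a k ≠ 0 := by
  lift k to ℕ using hk
  induction k with
  | zero => simpa [sl2String] using ha
  | succ k ih =>
    intro h0
    have := t.e_sl2String he hh ((k + 1 : ℕ) : ℤ)
    rw [h0, map_zero, show (((k + 1 : ℕ) : ℤ) - 1) = (k : ℤ) by simp, eq_comm] at this
    refine smul_ne_zero ?_ (ih (by omega)) this
    rw [show (n : ℂ) - (((k + 1 : ℕ) : ℤ) : ℂ) + 1 = ((n - k : ℤ) : ℂ) by push_cast; ring]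
    exact Int.cast_ne_zero.2 (by omega)

/-- The combination `u k + s u (n - k)` of a string `u`. -/
noncomputable def foldedString (f : Module.End ℂ M) (a : M) (n : ℕ) (s : ℂ) (k : ℤ) : M :=
  sl2String f a k + s • sl2String f a (n - k)

-- The reflection k ↦ n - k interchanges the coefficients of e and f on the string, so the folded
-- vectors obey the same recurrence as u_k, for every s.
include t he hh in
theorem Sl2Operators.sq_add_sq_foldedString (s : ℂ) (k : ℤ) :
    (e * e + f * f) (foldedString f a n s k) =
      (((n : ℂ) - k + 1) * (n - k + 2)) • foldedString f a n s (k - 2) +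
      (((k : ℂ) + 1) * (k + 2)) • foldedString f a n s (k + 2) := by
  simp only [foldedString, LinearMap.add_apply, Module.End.mul_apply, map_add, map_smul,
    t.e_sl2String he hh, f_sl2String]
  rw [show k - 1 - 1 = k - 2 by ring, show k + 1 + 1 = k + 2 by ring,
    show (n : ℤ) - k - 1 - 1 = n - (k + 2) by ring, show (n : ℤ) - k + 1 + 1 = n - (k - 2) by ring]
  push_cast
  module

include t he hh in
theorem Sl2Operators.e_f_add_f_e_foldedString (s : ℂ) (k : ℤ) :
    (e * f + f * e) (foldedString f a n s k) =
      (((k : ℂ) + 1) * (n - k) + k * (n - k + 1)) • foldedString f a n s k := by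
  simp only [foldedString, LinearMap.add_apply, Module.End.mul_apply, map_add, map_smul,
    t.e_sl2String he hh, f_sl2String, sub_add_cancel, add_sub_cancel_right]
  push_cast
  module

include t hh in
theorem Sl2Operators.h_h_foldedString (s : ℂ) (k : ℤ) :
    h (h (foldedString f a n s k)) = ((n : ℂ) - 2 * k) ^ 2 • foldedString f a n s k := by
  simp only [foldedString, map_add, map_smul, t.h_sl2String hh]
  push_cast
  module

-- For 2k < n the two terms have opposite nonzero weights, so h + (n - 2k) isolates the term in u_k.
include t he hh in
theorem Sl2Operators.foldedString_ne_zero (ha : a ≠ 0) (s : ℂ) {k : ℤ} (hk : 0 ≤ k)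
    (hkn : 2 * k < n) : foldedString f a n s k ≠ 0 := by
  intro h0
  have h1 := congrArg h h0
  rw [map_zero] at h1
  simp only [foldedString, map_add, map_smul, t.h_sl2String hh] at h0 h1
  push_cast at h1
  have h2 : (2 * ((n : ℂ) - 2 * k)) • sl2String f a k = 0 := by
    have h3 := congrArg (fun x ↦ ((n : ℂ) - 2 * k) • x) h0
    simp only [smul_zero] at h3
    calc _ = (((n : ℂ) - 2 * k) • sl2String f a k + s • (n - 2 * (n - k) : ℂ) •
          sl2String f a (n - k)) + ((n : ℂ) - 2 * k) • (sl2String f a k +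
          s • sl2String f a (n - k)) := by module
      _ = 0 := by rw [h1, h3, add_zero]
  refine smul_ne_zero (mul_ne_zero two_ne_zero ?_) (t.sl2String_ne_zero he hh ha hk (by omega)) h2
  rw [show (n : ℂ) - 2 * k = ((n - 2 * k : ℤ) : ℂ) by push_cast; ring]
  exact Int.cast_ne_zero.2 (by omega)

end String

/-! ### The Racah generators on a string. -/

section Modules

variable {R : Type*} [Ring R] [Algebra ℂ R] {A B C : R}
  {M : Type*} [AddCommGroup M] [Module ℂ M] [Module R M] [IsScalarTower ℂ R M]
  {e f h : Module.End ℂ M}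

/-- `A`, `B`, `C` act on `M` through the `sl₂` operators `e`, `f`, `h` by the formulas defining the
homomorphism from the universal Racah algebra to `U(sl₂)`. -/
structure RacahAction (A B C : R) (e f h : Module.End ℂ M) : Prop extends Sl2Operators e f h where
  adjoin_eq_top : Algebra.adjoin ℂ {A, B, C} = ⊤
  smul_A : ∀ v : M, A • v = (1 / 16 : ℂ) • ((e + f) ((e + f) v) - (4 : ℂ) • v)
  smul_B : ∀ v : M, B • v = (1 / 16 : ℂ) • (h (h v) - (4 : ℂ) • v)
  smul_C : ∀ v : M, C • v = (-1 / 16 : ℂ) • ((e - f) ((e - f) v) + (4 : ℂ) • v)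

namespace RacahAction

omit [IsScalarTower ℂ R M] in
theorem swap (t : RacahAction A B C e f h) : RacahAction A B C f e (-h) where
  __ := t.toSl2Operators.swap
  adjoin_eq_top := t.adjoin_eq_top
  smul_A v := by rw [t.smul_A, add_comm]
  smul_B v := by rw [t.smul_B]; simp
  smul_C v := by rw [t.smul_C, ← neg_sub e f]; simp only [LinearMap.neg_apply, map_neg, neg_neg]

omit [IsScalarTower ℂ R M] in
/-- The cyclic symmetry of the three generators `e + f`, `i (e - f)`, `h` of `sl₂`. -/
theorem rotate (t : RacahAction A B C e f h) :
    RacahAction C A B ((1 / 2 : ℂ) • (Complex.I • (e - f) - Complex.I • h))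
      ((1 / 2 : ℂ) • (Complex.I • (e - f) + Complex.I • h)) (e + f) := by
  -- For the new triple, e' + f' = i(e - f), i(e' - f') = h and h' = e + f.
  have hef := t.e_f
  have hhe := t.h_e
  have hhf := t.h_f
  refine ⟨⟨fun v ↦ ?_, fun v ↦ ?_, fun v ↦ ?_⟩, ?_, fun v ↦ ?_, t.smul_A, fun v ↦ ?_⟩
  · simp only [LinearMap.add_apply, LinearMap.sub_apply, LinearMap.smul_apply, map_add, map_sub,
      map_smul, hef, hhe, hhf]
    match_scalars <;> ring_nf <;> simp only [Complex.I_sq] <;> ring_nf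
  · simp only [LinearMap.add_apply, LinearMap.sub_apply, LinearMap.smul_apply, map_add, map_sub,
      map_smul, hef, hhe, hhf]
    module
  · simp only [LinearMap.add_apply, LinearMap.sub_apply, LinearMap.smul_apply, map_add, map_sub,
      map_smul, hef, hhe, hhf]
    module
  · rw [← t.adjoin_eq_top]
    congr 1
    ext x
    simp only [Set.mem_insert_iff, Set.mem_singleton_iff]
    tauto
  · rw [t.smul_C]
    simp only [LinearMap.add_apply, LinearMap.sub_apply, LinearMap.smul_apply, map_add, map_sub,
      map_smul]
    match_scalars <;> ring_nf <;> simp only [Complex.I_sq] <;> ring_nf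
  · rw [t.smul_B]
    simp only [LinearMap.add_apply, LinearMap.sub_apply, LinearMap.smul_apply, map_add, map_sub,
      map_smul]
    match_scalars <;> ring_nf
    simp only [Complex.I_sq]
    ring_nf

variable {a : M} {n : ℕ}

/-- The chain is k = ε + 2i, i ≤ d. Condition `hθ` says that no two distinct indices k, k' satisfy k
+ k' = n, so the B-eigenvalues are distinct. Condition `hend` says that e² + f² does not leave the
chain at its upper end; its diagonal term q allows for a reflected neighbour. The lower end closes
because index ε - 2 gives zero. -/
theorem foldedString_mem [FiniteDimensional ℂ M] (t : RacahAction A B C e f h) (he : e a = 0)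
    (hh : h a = (n : ℂ) • a) {s : ℂ} {ε d : ℕ} (hε : ε ≤ 1) (hd : ε + 2 * d ≤ n)
    (hw : ∀ i ≤ d, foldedString f a n s (ε + 2 * i : ℕ) ≠ 0)
    (hθ : ∀ i ≤ d, ∀ j ≤ d, i ≠ j → n ≠ 2 * ε + 2 * i + 2 * j)
    (hend : ∃ p q : ℂ, p ≠ 0 ∧ (e * e + f * f) (foldedString f a n s (ε + 2 * d : ℕ)) =
      p • foldedString f a n s ((ε + 2 * d : ℕ) - 2) + q • foldedString f a n s (ε + 2 * d : ℕ))
    (i : ℕ) (hi : i ≤ d) :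
    foldedString f a n s (ε + 2 * i : ℕ) ∈ sSup (leonardSimples A B C M) := by
  obtain ⟨p', q', hp', hend⟩ := hend
  set w : ℕ → M := fun i ↦ foldedString f a n s (ε + 2 * i : ℕ) with hw_def
  have hneg : foldedString f a n s ((ε : ℤ) - 2) = 0 := by
    rw [foldedString, sl2String_of_neg (by omega),
      t.sl2String_of_gt he hh (by omega), smul_zero, add_zero]
  have hT : TridiagonalOn (e * e + f * f) w d := by
    refine ⟨fun i ↦ if i = 0 then 0 else if i = d then p' else
        ((n : ℂ) - (ε + 2 * i : ℕ) + 1) * (n - (ε + 2 * i : ℕ) + 2),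
      fun i ↦ if i = d then q' else 0,
      fun i ↦ if i = d then 0 else (((ε + 2 * i : ℕ) : ℂ) + 1) * ((ε + 2 * i : ℕ) + 2),
      by simp, by simp, fun i hi ↦ ⟨?_, ?_⟩, fun i hi ↦ ?_⟩
    · simp only [Nat.succ_ne_zero, if_false]
      split_ifs with h1
      · exact hp'
      · rw [← Nat.cast_sub (by omega)]
        norm_cast
    · simp only [hi.ne, if_false]
      norm_cast
    · have hprev : ∀ i ≠ 0, (((ε + 2 * i : ℕ) : ℤ) - 2) = ((ε + 2 * (i - 1) : ℕ) : ℤ) :=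
        fun i hi ↦ by omega
      by_cases hid : i = d
      · subst hid
        simp only [hw_def, if_true, zero_smul, add_zero, hend]
        by_cases h0 : i = 0
        · subst h0; simp [hneg]
        · rw [hprev i h0, if_neg h0]
      · simp only [hw_def, hid, if_false, zero_smul, add_zero,
          t.sq_add_sq_foldedString he hh]
        by_cases h0 : i = 0
        · subst h0; simp [hneg]
        · rw [hprev i h0, if_neg h0]
          push_cast
          rfl
  suffices hS : ∃ S ∈ leonardSimples A B C M, ∀ i ≤ d, w i ∈ S by
    obtain ⟨S, hS, hwS⟩ := hS
    exact le_sSup hS (hwS i hi)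
  refine mem_leonardSimples_of_chain t.adjoin_eq_top
    (θ := fun i ↦ (1 / 16 : ℂ) * (((n : ℂ) - 2 * ((ε + 2 * i : ℕ) : ℤ)) ^ 2 - 4)) hw ?_ ?_ ?_ ?_
  · intro i hi j hj hij
    -- Equal eigenvalues mean n - 2k = ±(n - 2k'), that is k = k' or k + k' = n.
    by_contra hne
    have h1 : ((n : ℂ) - 2 * ((ε + 2 * i : ℕ) : ℤ)) ^ 2 = (n - 2 * ((ε + 2 * j : ℕ) : ℤ)) ^ 2 := by
      simp only at hij
      linear_combination 16 * hij
    rcases sq_eq_sq_iff_eq_or_eq_neg.1 h1 with h2 | h2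
    · have h3 : (n : ℤ) - 2 * (ε + 2 * i : ℕ) = n - 2 * (ε + 2 * j : ℕ) :=
        Int.cast_injective (α := ℂ) (by push_cast at h2 ⊢; exact h2)
      omega
    · have h3 : (n : ℤ) - 2 * (ε + 2 * i : ℕ) = -(n - 2 * (ε + 2 * j : ℕ)) :=
        Int.cast_injective (α := ℂ) (by push_cast at h2 ⊢; exact h2)
      have := hθ i hi j hj hne
      omega
  · intro i hi
    rw [t.smul_B, t.h_h_foldedString hh]
    module
  · refine hT.of_smul_add (c := -1 / 16) (by norm_num) (γ := fun i ↦ (1 / 16 : ℂ) *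
      (((((ε + 2 * i : ℕ) : ℤ) : ℂ) + 1) * (n - ((ε + 2 * i : ℕ) : ℤ)) +
        ((ε + 2 * i : ℕ) : ℤ) * (n - ((ε + 2 * i : ℕ) : ℤ) + 1) - 4)) fun i hi ↦ ?_
    have h1 := t.e_f_add_f_e_foldedString he hh s (ε + 2 * i : ℕ)
    have h2 : (e - f) ((e - f) (w i)) = (e * e + f * f) (w i) - (e * f + f * e) (w i) := by
      simp only [LinearMap.sub_apply, LinearMap.add_apply, Module.End.mul_apply, map_sub]
      abel
    rw [Algebra.lsmul_apply, t.smul_C, h2, h1]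
    module
  · refine hT.of_smul_add (c := 1 / 16) (by norm_num) (γ := fun i ↦ (1 / 16 : ℂ) *
      (((((ε + 2 * i : ℕ) : ℤ) : ℂ) + 1) * (n - ((ε + 2 * i : ℕ) : ℤ)) +
        ((ε + 2 * i : ℕ) : ℤ) * (n - ((ε + 2 * i : ℕ) : ℤ) + 1) - 4)) fun i hi ↦ ?_
    have h1 := t.e_f_add_f_e_foldedString he hh s (ε + 2 * i : ℕ)
    have h2 : (e + f) ((e + f) (w i)) = (e * e + f * f) (w i) + (e * f + f * e) (w i) := by
      simp only [LinearMap.add_apply, Module.End.mul_apply, map_add]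
      abel
    rw [Algebra.lsmul_apply, t.smul_A, h2, h1]
    module

/-- For odd `n` every vector of the string lies in a simple submodule. -/
theorem sl2String_mem_of_odd [FiniteDimensional ℂ M] (t : RacahAction A B C e f h) (he : e a = 0)
    (hh : h a = (n : ℂ) • a) (ha : a ≠ 0) (hn : Odd n) (k : ℕ) (hk : k ≤ n) :
    sl2String f a k ∈ sSup (leonardSimples A B C M) := by
  obtain ⟨m, rfl⟩ := hn
  -- No folding is needed, so s = 0: indices of equal parity cannot add up to the odd n.
  have h0 : ∀ j : ℤ, foldedString f a (2 * m + 1) 0 j = sl2String f a j := fun j ↦ by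
    simp [foldedString]
  have := t.foldedString_mem he hh (s := 0) (ε := k % 2) (d := m) (by omega) (by omega)
    (fun i hi ↦ by rw [h0]; exact t.sl2String_ne_zero he hh ha (by omega) (by omega))
    (fun i hi j hj hij ↦ by omega) ?_ (k / 2) (by omega)
  · rwa [h0, Nat.mod_add_div] at this
  · refine ⟨((2 * m + 1 : ℕ) - ((k % 2 + 2 * m : ℕ) : ℤ) + 1) *
      ((2 * m + 1 : ℕ) - ((k % 2 + 2 * m : ℕ) : ℤ) + 2), 0, ?_, ?_⟩
    · exact_mod_cast mul_ne_zero (a := ((2 * m + 1 : ℕ) : ℤ) - (k % 2 + 2 * m : ℕ) + 1)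
        (b := ((2 * m + 1 : ℕ) : ℤ) - (k % 2 + 2 * m : ℕ) + 2) (by omega) (by omega)
    · rw [t.sq_add_sq_foldedString he hh, h0 (_ + 2), t.sl2String_of_gt he hh (by omega),
        smul_zero, zero_smul]

/-- The reflection fixes the middle index m and acts on folded vectors by s. How a chain ends
depends on whether m has its parity and on s. -/
theorem foldedString_mem_of_even [FiniteDimensional ℂ M] (t : RacahAction A B C e f h)
    (he : e a = 0) {m : ℕ} (hh : h a = ((2 * m : ℕ) : ℂ) • a) (ha : a ≠ 0) {s : ℂ}
    (hs : s = 1 ∨ s = -1) (k : ℕ) (hk : k ≤ m) :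
    foldedString f a (2 * m) s k ∈ sSup (leonardSimples A B C M) := by
  have hfold : ∀ j : ℤ, foldedString f a (2 * m) s ((2 * m : ℕ) - j) =
      s • foldedString f a (2 * m) s j := fun j ↦ by
    have : s * s = 1 := by rcases hs with rfl | rfl <;> norm_num
    rw [foldedString, foldedString, sub_sub_cancel, smul_add, smul_smul, this, one_smul, add_comm]
  have hne : ∀ j : ℕ, j < m → foldedString f a (2 * m) s j ≠ 0 := fun j hj ↦
    t.foldedString_ne_zero he hh ha s (by omega) (by omega)
  obtain ⟨ε, hε⟩ : ∃ ε, ε = k % 2 := ⟨_, rfl⟩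
  have hkε : ε + 2 * (k / 2) = k := by rw [hε]; exact Nat.mod_add_div k 2
  rcases Nat.even_or_odd' (m - ε) with ⟨d, hd | hd⟩
  · rcases hs with rfl | rfl
    · have := t.foldedString_mem he hh (s := 1) (ε := ε) (d := d) (by omega) (by omega)
        (fun i hi ↦ ?_) (fun i hi j hj hij ↦ by omega) ?_ (k / 2) (by omega)
      · rwa [hkε] at this
      · rcases (show ε + 2 * i ≤ m by omega).lt_or_eq with h1 | h1
        · exact hne _ h1
        · rw [h1, foldedString, show ((2 * m : ℕ) : ℤ) - m = m by push_cast; ring, one_smul,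
            ← two_smul ℂ]
          exact smul_ne_zero two_ne_zero (t.sl2String_ne_zero he hh ha (by omega) (by omega))
      -- The chain ends at m, where the neighbours m - 2 and m + 2 coincide, doubling the
      -- coefficient.
      · refine ⟨2 * ((m + 1 : ℂ) * (m + 2)), 0, ?_, ?_⟩
        · norm_cast
        · have h1 : ε + 2 * d = m := by omega
          have h2 := hfold ((m : ℤ) - 2)
          rw [show ((2 * m : ℕ) : ℤ) - (m - 2) = m + 2 by push_cast; ring, one_smul] at h2
          rw [h1, t.sq_add_sq_foldedString he hh, h2]
          push_cast
          module
    -- For s = -1 the folded vector at m vanishes, so the chain stops at m - 2.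
    · rcases hk.lt_or_eq with hkm | rfl
      · have := t.foldedString_mem he hh (s := -1) (ε := ε) (d := d - 1) (by omega) (by omega)
          (fun i hi ↦ hne _ (by omega)) (fun i hi j hj hij ↦ by omega) ?_ (k / 2) (by omega)
        · rwa [hkε] at this
        · refine ⟨((m + 3 : ℂ) * (m + 4)), 0, ?_, ?_⟩
          · norm_cast
          · have h1 : ((ε + 2 * (d - 1) : ℕ) : ℤ) = m - 2 := by omega
            have h2 : foldedString f a (2 * m) (-1) m = 0 := by
              rw [foldedString, show ((2 * m : ℕ) : ℤ) - m = m by push_cast; ring]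
              simp
            rw [h1, t.sq_add_sq_foldedString he hh, sub_add_cancel, h2]
            push_cast
            module
      · have : foldedString f a (2 * k) (-1) k = 0 := by
          rw [foldedString, show ((2 * k : ℕ) : ℤ) - k = k by push_cast; ring]
          simp
        rw [this]
        exact Submodule.zero_mem _
  · have := t.foldedString_mem he hh (s := s) (ε := ε) (d := d) (by omega) (by omega)
      (fun i hi ↦ hne _ (by omega)) (fun i hi j hj hij ↦ by omega) ?_ (k / 2) (by omega)
    · rwa [hkε] at this
    -- The chain ends at m - 1, whose upper neighbour m + 1 is its own reflection; this gives the
    -- diagonal term s m (m + 1).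
    · refine ⟨((m + 2 : ℂ) * (m + 3)), s * (m * (m + 1)), ?_, ?_⟩
      · norm_cast
      · have h1 : ((ε + 2 * d : ℕ) : ℤ) = m - 1 := by omega
        have h2 := hfold ((m : ℤ) - 1)
        rw [show ((2 * m : ℕ) : ℤ) - (m - 1) = m - 1 + 2 by push_cast; ring] at h2
        rw [h1, t.sq_add_sq_foldedString he hh, h2]
        push_cast
        module

theorem sl2String_mem [FiniteDimensional ℂ M] (t : RacahAction A B C e f h) (he : e a = 0)
    (hh : h a = (n : ℂ) • a) (k : ℕ) : sl2String f a k ∈ sSup (leonardSimples A B C M) := by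
  rcases eq_or_ne a 0 with rfl | ha
  · simp [sl2String]
  rcases lt_or_ge n k with hk | hk
  · rw [t.sl2String_of_gt he hh (by omega)]
    exact Submodule.zero_mem _
  rcases Nat.even_or_odd' n with ⟨m, rfl | rfl⟩
  -- The half sum and half difference of the foldings for s = 1 and s = -1 recover u_j and u_{2m-j}.
  · have half : ∀ j : ℕ, j ≤ m → sl2String f a j ∈ sSup (leonardSimples A B C M) ∧
        sl2String f a ((2 * m : ℕ) - j) ∈ sSup (leonardSimples A B C M) := fun j hj ↦ by
      have h1 := t.foldedString_mem_of_even he hh ha (.inl rfl) j hj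
      have h2 := t.foldedString_mem_of_even he hh ha (.inr rfl) j hj
      have hsmul := fun {x : M} ↦
        Submodule.smul_of_tower_mem (x := x) (sSup (leonardSimples A B C M)) (1 / 2 : ℂ)
      constructor
      · convert hsmul (add_mem h1 h2) using 1
        simp only [foldedString]
        module
      · convert hsmul (sub_mem h1 h2) using 1
        simp only [foldedString]
        module
    rcases le_total k m with hkm | hkm
    · exact (half k hkm).1
    · have := (half (2 * m - k) (by omega)).2
      rwa [show ((2 * m : ℕ) : ℤ) - (2 * m - k : ℕ) = k by omega] at this
  · exact t.sl2String_mem_of_odd he hh ha (odd_two_mul_add_one m) k hk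

theorem f_pow_mem [FiniteDimensional ℂ M] (t : RacahAction A B C e f h) (he : e a = 0)
    (hh : h a = (n : ℂ) • a) (k : ℕ) : (f ^ k) a ∈ sSup (leonardSimples A B C M) := by
  have := Submodule.smul_of_tower_mem (sSup (leonardSimples A B C M)) (k.factorial : ℂ)
    (t.sl2String_mem he hh k)
  rwa [sl2String_natCast, smul_smul,
    mul_inv_cancel₀ (Nat.cast_ne_zero.2 k.factorial_ne_zero), one_smul] at this

theorem sSup_leonardSimples [FiniteDimensional ℂ M] (t : RacahAction A B C e f h) :
    sSup (leonardSimples A B C M) = ⊤ := by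
  refine (Submodule.restrictScalars_eq_top_iff ℂ R M).1 (t.eq_top_of_strings ?_ ?_)
  · exact fun n a he hh k ↦ t.f_pow_mem he hh k
  · exact fun n b hf hh k ↦ t.swap.f_pow_mem hf hh k

end RacahAction

end Modules

/-! ### The pullback module and the theorem. -/

namespace Racah

theorem two_mul_Δ : (2 : Racah) * Δ = A * B - B * A := by
  have h := RingQuot.mkAlgHom_rel ℂ RacahFree.Rel.ab
  change mk _ = mk _ at h
  rw [Ring.lie_def, map_sub, map_mul, map_mul, map_mul, map_ofNat] at h
  exact h.symm

/-- The generator Δ is redundant, being half the commutator [A, B]. -/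
theorem adjoin_A_B_C : Algebra.adjoin ℂ {A, B, C} = (⊤ : Subalgebra ℂ Racah) := by
  have hsurj : Function.Surjective mk := RingQuot.mkAlgHom_surjective ℂ RacahFree.Rel
  have hA : A ∈ Algebra.adjoin ℂ {A, B, C} := Algebra.subset_adjoin (by simp)
  have hB : B ∈ Algebra.adjoin ℂ {A, B, C} := Algebra.subset_adjoin (by simp)
  have hC : C ∈ Algebra.adjoin ℂ {A, B, C} := Algebra.subset_adjoin (by simp)
  have hΔ : Δ ∈ Algebra.adjoin ℂ {A, B, C} := by
    have h2 : (1 / 2 : ℂ) • ((2 : Racah) * Δ) = Δ := by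
      rw [two_mul]; module
    rw [← h2, two_mul_Δ]
    exact Subalgebra.smul_mem _ (sub_mem (mul_mem hA hB) (mul_mem hB hA)) _
  rw [← (AlgHom.range_eq_top mk).2 hsurj, ← Algebra.map_top, ← FreeAlgebra.adjoin_range_ι,
    AlgHom.map_adjoin]
  refine le_antisymm ?_ (Algebra.adjoin_le ?_)
  · rw [← AlgHom.map_adjoin, FreeAlgebra.adjoin_range_ι, Algebra.map_top,
      (AlgHom.range_eq_top mk).2 hsurj]
    exact le_top
  · rintro _ ⟨_, ⟨g, rfl⟩, rfl⟩
    cases g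
    · exact hA
    · exact hB
    · exact hC
    · exact hΔ

/-- The action of `U(sl₂)` on the pullback by complex-linear operators. -/
def sl2Action (V : Type u) [AddCommGroup V] [Module ℂ V] [Module USl2 V] [IsScalarTower ℂ USl2 V]
    (x : USl2) : Module.End ℂ (SharpPullback V) :=
  Algebra.lsmul ℂ ℂ V x

theorem racahAction_sharpPullback (V : Type u) [AddCommGroup V] [Module ℂ V] [Module USl2 V]
    [IsScalarTower ℂ USl2 V] :
    RacahAction A B C (sl2Action V USl2.E) (sl2Action V USl2.F) (sl2Action V USl2.H) where
  e_f := by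
    have h : ∀ v : V, USl2.E • USl2.F • v = USl2.F • USl2.E • v + USl2.H • v := fun v ↦ by
      rw [← mul_smul, ← mul_smul, USl2.F_mul_E, sub_smul, sub_add_cancel]
    exact h
  h_e := by
    have h : ∀ v : V, USl2.H • USl2.E • v = USl2.E • USl2.H • v + (2 : ℂ) • USl2.E • v := fun v ↦ by
      rw [← mul_smul, ← mul_smul, USl2.H_mul_E, add_smul, smul_assoc]
    exact h
  h_f := by
    have h : ∀ v : V, USl2.H • USl2.F • v = USl2.F • USl2.H • v - (2 : ℂ) • USl2.F • v := fun v ↦ by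
      rw [← mul_smul, ← mul_smul, USl2.H_mul_F, sub_smul, smul_assoc]
    exact h
  adjoin_eq_top := adjoin_A_B_C
  smul_A := by
    have h : ∀ v : V, sharp A • v = (1 / 16 : ℂ) •
        ((USl2.E • (USl2.E • v + USl2.F • v) + USl2.F • (USl2.E • v + USl2.F • v)) -
          (4 : ℂ) • v) := fun v ↦ by
      rw [sharp_A, ← sharpGen.eq_1, sharpGen_A]
      simp only [smul_assoc, sub_smul, mul_smul, add_smul, one_smul]
    exact h
  smul_B := by
    have h : ∀ v : V, sharp B • v = (1 / 16 : ℂ) • (USl2.H • USl2.H • v - (4 : ℂ) • v) :=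
      fun v ↦ by
        rw [sharp_B, ← sharpGen.eq_2, sharpGen_B]
        simp only [smul_assoc, sub_smul, mul_smul, one_smul]
    exact h
  smul_C := by
    have h : ∀ v : V, sharp C • v = (-1 / 16 : ℂ) •
        ((USl2.E • (USl2.E • v - USl2.F • v) - USl2.F • (USl2.E • v - USl2.F • v)) +
          (4 : ℂ) • v) := fun v ↦ by
      rw [sharp_C, ← sharpGen.eq_3, sharpGen_C]
      simp only [smul_assoc, sub_smul, mul_smul, add_smul, one_smul]
    exact h

end Racah

theorem IsSemisimpleModule.isCompletelyReducible (R : Type) [Ring R] (M : Type u) [AddCommGroup M]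
    [Module R M] [IsSemisimpleModule R M] : IsCompletelyReducible R M := by
  obtain ⟨s, φ, -, hs⟩ := IsSemisimpleModule.exists_linearEquiv_dfinsupp R M
  exact ⟨s, fun m ↦ m.1, inferInstance, inferInstance, hs, ⟨φ⟩⟩

theorem theorem1p7 (V : Type u) [AddCommGroup V] [Module ℂ V] [Module USl2 V]
    [IsScalarTower ℂ USl2 V] [FiniteDimensional ℂ V] :
    IsCompletelyReducible Racah (SharpPullback V) ∧
    ∀ W : Submodule Racah (SharpPullback V), IsSimpleModule Racah W →
      IsLeonardTriple (Algebra.lsmul ℂ ℂ W Racah.A) (Algebra.lsmul ℂ ℂ W Racah.B)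
        (Algebra.lsmul ℂ ℂ W Racah.C) := by
  have : FiniteDimensional ℂ (SharpPullback V) := inferInstanceAs (FiniteDimensional ℂ V)
  have t := Racah.racahAction_sharpPullback V
  have := isSemisimpleModule_of_sSup_leonardSimples t.sSup_leonardSimples
  refine ⟨IsSemisimpleModule.isCompletelyReducible _ _, fun W hW ↦ ⟨?_, hW.nontrivial, ?_, ?_, ?_⟩⟩
  · exact inferInstanceAs (FiniteDimensional ℂ (W.restrictScalars ℂ))
  -- The diagonal operator is always the middle one of the `RacahAction`: rotating once puts A
  -- there, rotating twice puts C there.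
  · exact hasLeonardBasis_of_sSup_leonardSimples t.rotate.sSup_leonardSimples W
  · exact hasLeonardBasis_of_sSup_leonardSimples t.sSup_leonardSimples W
  · exact hasLeonardBasis_of_sSup_leonardSimples t.rotate.rotate.sSup_leonardSimples W
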